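/- Let $A$ be a binary linear code of length $n$ and minimum distance $d_0$. For $m\ge 1$ and a permutation $\pi$ of the $N=nm$ edges, let $G_\pi$ be the $n$-regular bipartite graph (parallel edges allowed) with parts $V_1,V_2$ of size $m$ in which $\pi$ establishes how the $N$ edges originating in $V_1$ ($n$ at each vertex) are attached to the $N$ edge slots in $V_2$ ($n$ at each vertex). The ensemble $\mathcal G(A,m)$ consists of the codes $C(G_\pi)=\{x\in\{0,1\}^N: x(v)\in A \text{ for all } v\in V_1\cup V_2\}$, where $x(v)$ is the restriction of $x$ to the $n$ edges at $v$. For an integer $t\ge0$ with $2t+1\le d_0$, let $\psi_{A,t}(z)$ be the unique codeword of $A$ within Hamming distance $t$ of $z$ if it exists, and $\psi_{A,t}(z)=z$ otherwise. Iterative decoding replaces, in odd iterations, $y(v)$ by $\psi_{A,t}(y(v))$ for all $v\in V_1$, and in even iterations for all $v\in V_2$. A code of the ensemble corrects $w$ errors if there is a number of iterations after which this algorithm, started from any vector that differs from a codeword in at most $w$ coordinates, has arrived at that codeword and remains there. Let $h$ be the binary entropy function and $\log$ the logarithm, both to base $2$, and let $\varepsilon_n=(1+\log n)/n$. For $0<\tau<1/2$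 put $$\sigma_0=\sigma_0(n,\tau)=\sup\Big\{0<x<\tau:\ (1-x)\,h\Big(\frac{x(1-\tau)}{1-x}\Big)+x\,h(\tau)+\varepsilon_n<h(x)\Big\},$$ with $\sigma_0=0$ if the set is empty. Fix $\tau\in(0,1/2)$. Then: 1. For every $n$, every integer $t=\tau n$ and every binary linear code $A$ of length $n$ with distance $d_0\ge 2t+1$: for every $\sigma\le\sigma_0(n,\tau)$ and all sufficiently large $m$, the ensemble $\mathcal G(A,m)$ contains a code that corrects $\sigma\tau N$ errors. 2. $\sigma_0(n,\tau)\to\tau$ as $n\to\infty$. 3. Consequently, for every $\rho<\tau^2$ there is an $n_0$ such that for every $n\ge n_0$, every integer $t=\tau n$, every binary linear code $A$ of length $n$ with distance at least $2t+1$, and all sufficiently large $m$, the ensemble $\mathcal G(A,m)$ contains a code that corrects $\rho N$ errors. -/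

import Mathlib

noncomputable section

namespace BipartiteGraphCode

/-- Binary words of length `n`; a binary linear code of length `n` is a submodule of this space. -/
abbrev Word (n : ℕ) : Type := Fin n → ZMod 2

/-- Minimum distance of a binary linear code. It is `0` for the trivial code, so a hypothesis
`2 * t + 1 ≤ minDist A` forces `A` to contain a nonzero word. -/
def minDist {n : ℕ} (A : Submodule (ZMod 2) (Word n)) : ℕ :=
  sInf {d : ℕ | ∃ x ∈ A, ∃ y ∈ A, x ≠ y ∧ hammingDist x y = d}

/-- The `N = n * m` edges of the graph (the coordinates of the graph code). The edge `(v, i)` is the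
one that leaves the `i`-th socket of the vertex `v` in the part `V₁`; both parts are copies of
`Fin m`, and each vertex has the `n` sockets `Fin n`. -/
abbrev Edge (n m : ℕ) : Type := Fin m × Fin n

/-- Vectors in `{0,1}^N`. -/
abbrev EdgeWord (n m : ℕ) : Type := Edge n m → ZMod 2

/-- The projection `x(v)` of `x` on the edges incident to the vertex `v` of `V₁`. -/
def proj₁ {n m : ℕ} (x : EdgeWord n m) (v : Fin m) : Word n :=
  fun i => x (v, i)

/-- The graph is given by a permutation `π` of `N` elements: the edge `e` enters the socket `π e` of
the part `V₂`. This is the projection `x(v)` of `x` on the edges incident to the vertex `v`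
of `V₂`. -/
def proj₂ {n m : ℕ} (π : Equiv.Perm (Edge n m)) (x : EdgeWord n m) (v : Fin m) : Word n :=
  fun i => x (π.symm (v, i))

/-- The graph code `C(G)` with local code `A`, where `G` is the bipartite graph defined by `π`. The
ensemble `𝒢(A, m)` consists of the codes `graphCode A π`, with `π` running over all permutations of
the `N` edges. -/
def graphCode {n m : ℕ} (A : Submodule (ZMod 2) (Word n)) (π : Equiv.Perm (Edge n m)) :
    Submodule (ZMod 2) (EdgeWord n m) where
  carrier := {x | (∀ v, proj₁ x v ∈ A) ∧ ∀ v, proj₂ π x v ∈ A}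
  add_mem' := fun hx hy =>
    ⟨fun v => A.add_mem (hx.1 v) (hy.1 v), fun v => A.add_mem (hx.2 v) (hy.2 v)⟩
  zero_mem' := ⟨fun _ => A.zero_mem, fun _ => A.zero_mem⟩
  smul_mem' := fun c _ hx => ⟨fun v => A.smul_mem c (hx.1 v), fun v => A.smul_mem c (hx.2 v)⟩

open Classical in
/-- The local decoder `ψ_{A,t}`: the unique codeword of `A` within distance `t` of `z`, if there is
exactly one, and `z` itself otherwise. -/
def localDecode {n : ℕ} (A : Submodule (ZMod 2) (Word n)) (t : ℕ) (z : Word n) : Word n :=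
  if h : ∃! x : Word n, x ∈ A ∧ hammingDist z x ≤ t then h.choose else z

/-- Decode all the vertices of `V₁` in parallel. -/
def decode₁ {n m : ℕ} (A : Submodule (ZMod 2) (Word n)) (t : ℕ) (y : EdgeWord n m) :
    EdgeWord n m :=
  fun e => localDecode A t (proj₁ y e.1) e.2

/-- Decode all the vertices of `V₂` in parallel. -/
def decode₂ {n m : ℕ} (A : Submodule (ZMod 2) (Word n)) (t : ℕ) (π : Equiv.Perm (Edge n m))
    (y : EdgeWord n m) : EdgeWord n m :=
  fun e => localDecode A t (proj₂ π y (π e).1) (π e).2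

/-- The iterative decoding algorithm: `iterDecode A t π y k` is the estimate after `k` iterations,
started from the received vector `y`. The 1st, 3rd, 5th, … iterations decode `V₁`, the 2nd, 4th,
6th, … decode `V₂`. -/
def iterDecode {n m : ℕ} (A : Submodule (ZMod 2) (Word n)) (t : ℕ) (π : Equiv.Perm (Edge n m))
    (y : EdgeWord n m) : ℕ → EdgeWord n m
  | 0 => y
  | k + 1 =>
    if Even k then decode₁ A t (iterDecode A t π y k) else decode₂ A t π (iterDecode A t π y k)

/-- The code `graphCode A π` corrects `w` errors under iterative decoding: after sufficiently many
iterations, every combination of at most `w` errors in every transmitted codeword is removed. -/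
def CorrectsErrors {n m : ℕ} (A : Submodule (ZMod 2) (Word n)) (t : ℕ)
    (π : Equiv.Perm (Edge n m)) (w : ℝ) : Prop :=
  ∃ k₀ : ℕ, ∀ c ∈ graphCode A π, ∀ y : EdgeWord n m, (hammingDist y c : ℝ) ≤ w →
    ∀ k ≥ k₀, iterDecode A t π y k = c

/-- The binary entropy function in bits. -/
def h (x : ℝ) : ℝ := Real.binEntropy x / Real.log 2

/-- `ε_n = (1 + log₂ n) / n`. -/
def eps (n : ℕ) : ℝ := (1 + Real.logb 2 n) / n

/-- The threshold `σ₀(n, τ)`: the supremum of the `x` in `(0, τ)` that satisfy the entropy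
inequality (`0` if there are none). -/
def sigma₀ (n : ℕ) (τ : ℝ) : ℝ :=
  sSup {x : ℝ | 0 < x ∧ x < τ ∧
    (1 - x) * h (x * (1 - τ) / (1 - x)) + x * h τ + eps n < h x}

end BipartiteGraphCode

end

/-! A vertex stays in error after its part is decoded only if more than `t` of its edges were
erroneous, and these edges all lead to vertices that were bad in the other part. If no two vertex
sets of equal size `s < σ * m` are joined by `s * t` or more edges (`IsSparse`), the number of bad
vertices, once below `σ * m`, drops in every iteration until it is zero; with at most `σ * m * t`
errors it is below `σ * m` after the first iteration (`IsSparse.correctsErrors`).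

Sparse graphs exist by a union bound. Put `x = s / m` and let `H` be the entropy in nats. For a
random permutation a given pair of sets is too densely joined with probability at most `(N + 1) *
exp (-N * overlapRate τ x)` (`card_perm_large_inter_le`), and there are at most `exp (2 * m * H x)`
pairs. The sum tends to `0` if `n * overlapRate τ x ≥ κ * H x` for all `x < σ` with a fixed `κ > 4`
(`exists_rate_bound`).

The definition of `σ₀` bounds `overlapRate` from below only at certain points. The bound passes to
all smaller `x` because `overlapRate τ x - l * H x` is first concave, then convex
(`le_overlapRate_of_le`). Finally `overlapRate` is positive on `(0, τ)` and `ε_n → 0`, so `σ₀ → τ`.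
-/

noncomputable section

/-! ### Entropy calculus: the overlap rate and the threshold `σ₀`. -/

namespace BipartiteGraphCode

open Real Set

/-- The mutual information (in nats) of two indicator variables of mean `x` that are both `1` with
probability `τ * x`: the exponent of the probability that two random sets of density `x` have an
overlap of relative size `τ`. -/
def overlapRate (τ x : ℝ) : ℝ :=
  2 * negMulLog x + 2 * negMulLog (1 - x) - negMulLog (τ * x) - 2 * negMulLog ((1 - τ) * x)
    - negMulLog (1 - (2 - τ) * x)

/-- The derivative of `overlapRate τ x - l * binEntropy x` in `x`. -/
def overlapRateDeriv (τ l x : ℝ) : ℝ :=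
  -2 * log x + 2 * log (1 - x) + τ * log (τ * x) + 2 * ((1 - τ) * log ((1 - τ) * x))
    - (2 - τ) * log (1 - (2 - τ) * x) - l * (log (1 - x) - log x)

lemma continuous_overlapRate_sub (τ l : ℝ) :
    Continuous fun x => overlapRate τ x - l * binEntropy x := by
  unfold overlapRate
  have := continuous_negMulLog
  have := binEntropy_continuous
  fun_prop

lemma one_sub_two_sub_mul_pos {τ x : ℝ} (hτ1 : τ < 1 / 2) (hx0 : 0 < x) (hx : x ≤ τ) :
    0 < 1 - (2 - τ) * x := by
  nlinarith

lemma hasDerivAt_overlapRate_sub {τ x : ℝ} (l : ℝ) (hτ1 : τ < 1 / 2) (hx0 : 0 < x) (hx : x ≤ τ) :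
    HasDerivAt (fun x => overlapRate τ x - l * binEntropy x) (overlapRateDeriv τ l x) x := by
  have h3 := one_sub_two_sub_mul_pos hτ1 hx0 hx
  have hτ0 : 0 < τ := by linarith
  have d1 := hasDerivAt_negMulLog hx0.ne'
  have d2 := (hasDerivAt_negMulLog (x := 1 - x) (by linarith)).comp x
    ((hasDerivAt_id x).const_sub 1)
  have d3 := (hasDerivAt_negMulLog (x := τ * x) (by positivity)).comp x
    ((hasDerivAt_id x).const_mul τ)
  have d4 := (hasDerivAt_negMulLog (x := (1 - τ) * x)
    (mul_pos (by linarith) hx0).ne').comp x ((hasDerivAt_id x).const_mul (1 - τ))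
  have d5 := (hasDerivAt_negMulLog h3.ne').comp x
    (((hasDerivAt_id x).const_mul (2 - τ)).const_sub 1)
  have d6 := (hasDerivAt_binEntropy (p := x) hx0.ne' (by linarith)).const_mul l
  refine ((((((d1.const_mul 2).add (d2.const_mul 2)).sub d3).sub (d4.const_mul 2)).sub d5).sub
    d6).congr_deriv ?_
  simp only [overlapRateDeriv]
  ring

/-- The denominator is positive on `(0, τ]`, so the sign is that of an affine function of `x`,
increasing when `l < 1`. -/
lemma hasDerivAt_overlapRateDeriv {τ x : ℝ} (l : ℝ) (hτ1 : τ < 1 / 2) (hx0 : 0 < x)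
    (hx : x ≤ τ) :
    HasDerivAt (overlapRateDeriv τ l)
      (((2 - τ) * x * (1 - l) - (τ - l)) / (x * (1 - x) * (1 - (2 - τ) * x))) x := by
  have h3 := one_sub_two_sub_mul_pos hτ1 hx0 hx
  have h2 : 0 < 1 - x := by linarith
  have hτ0 : 0 < τ := by linarith
  have h4 : 0 < 1 - τ := by linarith
  have d1 := hasDerivAt_log hx0.ne'
  have d2 := ((hasDerivAt_id x).const_sub 1).log h2.ne'
  have d3 := ((hasDerivAt_id x).const_mul τ).log (by simp; constructor <;> positivity)
  have d4 := ((hasDerivAt_id x).const_mul (1 - τ)).log (mul_pos h4 hx0).ne'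
  have d5 := (((hasDerivAt_id x).const_mul (2 - τ)).const_sub 1).log h3.ne'
  refine ((((((d1.const_mul (-2)).add (d2.const_mul 2)).add (d3.const_mul τ)).add
    ((d4.const_mul (1 - τ)).const_mul 2)).sub (d5.const_mul (2 - τ))).sub
    ((d2.sub d1).const_mul l)).congr_deriv ?_
  simp only [id]
  obtain ⟨q, hq⟩ : ∃ q, q = 1 - (2 - τ) * x := ⟨_, rfl⟩
  rw [← hq] at h3 ⊢
  field_simp
  rw [hq]
  ring

/-- The sign of the second derivative of `overlapRate τ x - l * binEntropy x` increases. -/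
lemma exists_second_deriv_sign {τ l a b : ℝ} (hτ1 : τ < 1 / 2) (ha : 0 < a) (hab : a < b)
    (hb : b ≤ τ) : ∃ c ∈ Ioo a b, ∃ D > 0, overlapRateDeriv τ l b - overlapRateDeriv τ l a =
      D * ((2 - τ) * c * (1 - l) - (τ - l)) := by
  obtain ⟨c, hc, h⟩ := exists_hasDerivAt_eq_slope (overlapRateDeriv τ l) _ hab
    (fun x hx => (hasDerivAt_overlapRateDeriv l hτ1 (ha.trans_le hx.1)
      (hx.2.trans hb)).continuousAt.continuousWithinAt)
    (fun x hx => hasDerivAt_overlapRateDeriv l hτ1 (ha.trans hx.1) (hx.2.le.trans hb))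
  have h3 := one_sub_two_sub_mul_pos hτ1 (ha.trans hc.1) (hc.2.le.trans hb)
  have h2 : 0 < 1 - c := by linarith [hc.2]
  have h1 : 0 < c := ha.trans hc.1
  refine ⟨c, hc, (b - a) / (c * (1 - c) * (1 - (2 - τ) * c)),
    div_pos (by linarith) (by positivity), ?_⟩
  have : b - a ≠ 0 := by linarith
  rw [eq_div_iff this] at h
  rw [← h]
  ring

/-- The left end may be `0`: the mean value theorem needs only continuity there. -/
lemma exists_deriv_eq_sub {τ l a b : ℝ} (hτ1 : τ < 1 / 2) (ha : 0 ≤ a) (hab : a < b)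
    (hb : b ≤ τ) : ∃ c ∈ Ioo a b, overlapRateDeriv τ l c * (b - a) =
      (overlapRate τ b - l * binEntropy b) - (overlapRate τ a - l * binEntropy a) := by
  obtain ⟨c, hc, h⟩ := exists_hasDerivAt_eq_slope (fun x => overlapRate τ x - l * binEntropy x) _
    hab (continuous_overlapRate_sub τ l).continuousOn
    (fun x hx => hasDerivAt_overlapRate_sub l hτ1 (ha.trans_lt hx.1) (hx.2.le.trans hb))
  refine ⟨c, hc, ?_⟩
  rw [h, div_mul_cancel₀]
  linarith

@[simp] lemma overlapRate_zero (τ : ℝ) : overlapRate τ 0 = 0 := by simp [overlapRate]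

lemma overlapRate_self {τ : ℝ} (hτ0 : 0 < τ) (hτ1 : τ < 1 / 2) : overlapRate τ τ = 0 := by
  have h1 : 0 < 1 - τ := by linarith
  have e : 1 - (2 - τ) * τ = (1 - τ) * (1 - τ) := by ring
  rw [overlapRate, e, negMulLog_mul, negMulLog_mul, negMulLog_mul]
  ring

lemma overlapRateDeriv_self {τ : ℝ} (hτ0 : 0 < τ) (hτ1 : τ < 1 / 2) :
    overlapRateDeriv τ 0 τ = 0 := by
  have h1 : 0 < 1 - τ := by linarith
  have e : 1 - (2 - τ) * τ = (1 - τ) * (1 - τ) := by ring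
  rw [overlapRateDeriv, e, log_mul hτ0.ne' hτ0.ne', log_mul h1.ne' hτ0.ne', log_mul h1.ne' h1.ne']
  ring

/-- The rate vanishes at `0` and, to second order, at `τ`, where the two indicators are independent.
A value `≤ 0` in between would make the second derivative nonnegative at a point and nonpositive at
a later one, against its strictly increasing sign. -/
lemma overlapRate_pos {τ x : ℝ} (hτ1 : τ < 1 / 2) (hx0 : 0 < x) (hx : x < τ) :
    0 < overlapRate τ x := by
  by_contra! hneg
  have hτ0 : 0 < τ := by linarith
  obtain ⟨a, ha, h1⟩ := exists_deriv_eq_sub (l := 0) hτ1 le_rfl hx0 hx.le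
  obtain ⟨b, hb, h2⟩ := exists_deriv_eq_sub (l := 0) hτ1 hx0.le hx le_rfl
  rw [overlapRate_zero] at h1
  rw [overlapRate_self hτ0 hτ1] at h2
  have h3 : overlapRateDeriv τ 0 a ≤ 0 := by nlinarith
  have h4 : 0 ≤ overlapRateDeriv τ 0 b := by
    by_contra! h
    nlinarith
  obtain ⟨c, hc, D, hD, h5⟩ := exists_second_deriv_sign (l := 0) hτ1 ha.1 (ha.2.trans hb.1) hb.2.le
  obtain ⟨d, hd, D', hD', h6⟩ := exists_second_deriv_sign (l := 0) hτ1 (hx0.trans hb.1) hb.2 le_rfl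
  rw [overlapRateDeriv_self hτ0 hτ1] at h6
  have h7 : 0 ≤ (2 - τ) * c * (1 - 0) - (τ - 0) := by
    by_contra! h
    nlinarith
  have h8 : (2 - τ) * d * (1 - 0) - (τ - 0) ≤ 0 := by
    by_contra! h
    nlinarith
  nlinarith [hc.2, hd.1]

lemma binEntropy_pos_of_lt {x : ℝ} (hx0 : 0 < x) (hx : x < 1 / 2) : 0 < binEntropy x :=
  binEntropy_pos hx0 (by linarith)

/-- For `l = τ` the constant term `τ - l` disappears and the difference is strictly convex; it is
`0` at `0` and negative at `τ`. -/
lemma overlapRate_lt {τ x : ℝ} (hτ1 : τ < 1 / 2) (hx0 : 0 < x) (hx : x < τ) :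
    overlapRate τ x < τ * binEntropy x := by
  by_contra! hneg
  have hτ0 : 0 < τ := by linarith
  have hent := binEntropy_pos_of_lt hτ0 hτ1
  obtain ⟨a, ha, h1⟩ := exists_deriv_eq_sub (l := τ) hτ1 le_rfl hx0 hx.le
  obtain ⟨b, hb, h2⟩ := exists_deriv_eq_sub (l := τ) hτ1 hx0.le hx le_rfl
  rw [overlapRate_zero, binEntropy_zero] at h1
  rw [overlapRate_self hτ0 hτ1] at h2
  have h3 : 0 ≤ overlapRateDeriv τ τ a := by
    by_contra! h
    nlinarith
  have h4 : overlapRateDeriv τ τ b < 0 := by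
    by_contra! h
    nlinarith [mul_pos hτ0 hent]
  obtain ⟨c, hc, D, hD, h5⟩ := exists_second_deriv_sign (l := τ) hτ1 ha.1 (ha.2.trans hb.1) hb.2.le
  have hc0 : 0 < c := ha.1.trans hc.1
  have : 0 < D * ((2 - τ) * c * (1 - τ) - (τ - τ)) := by
    rw [sub_self, sub_zero]
    exact mul_pos hD (mul_pos (mul_pos (by linarith) hc0) (by linarith))
  linarith

/-- A lower bound for the ratio `overlapRate τ x / binEntropy x` propagates to smaller `x`. -/
lemma le_overlapRate_of_le {τ l x b : ℝ} (hτ1 : τ < 1 / 2) (hl0 : 0 < l) (hl1 : l < 1)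
    (hx0 : 0 < x) (hxb : x ≤ b) (hb : b < τ) (h : l * binEntropy b ≤ overlapRate τ b) :
    l * binEntropy x ≤ overlapRate τ x := by
  by_contra! hneg
  have hτ0 : 0 < τ := by linarith
  have hxb : x < b := lt_of_le_of_ne hxb (by rintro rfl; linarith)
  have hent := mul_pos hl0 (binEntropy_pos_of_lt hτ0 hτ1)
  -- The difference is `0` at `0`, negative at `x`, nonnegative at `b` and negative at `τ`. Its
  -- derivative is thus negative, positive, negative in turn, so its second derivative would go from
  -- positive to negative.
  obtain ⟨a₁, ha₁, h1⟩ := exists_deriv_eq_sub (l := l) hτ1 le_rfl hx0 (hxb.le.trans hb.le)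
  obtain ⟨a₂, ha₂, h2⟩ := exists_deriv_eq_sub (l := l) hτ1 hx0.le hxb hb.le
  obtain ⟨a₃, ha₃, h3⟩ := exists_deriv_eq_sub (l := l) hτ1 (hx0.trans hxb).le hb le_rfl
  rw [overlapRate_zero, binEntropy_zero] at h1
  rw [overlapRate_self hτ0 hτ1] at h3
  have g1 : overlapRateDeriv τ l a₁ < 0 := by
    by_contra! h
    nlinarith
  have g2 : 0 < overlapRateDeriv τ l a₂ := by
    by_contra! h
    nlinarith
  have g3 : overlapRateDeriv τ l a₃ < 0 := by
    by_contra! h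
    nlinarith
  obtain ⟨c, hc, D, hD, h5⟩ := exists_second_deriv_sign (l := l) hτ1 ha₁.1 (ha₁.2.trans ha₂.1)
    (ha₂.2.le.trans hb.le)
  obtain ⟨d, hd, D', hD', h6⟩ := exists_second_deriv_sign (l := l) hτ1 (hx0.trans ha₂.1)
    (ha₂.2.trans ha₃.1) ha₃.2.le
  have h7 : 0 < (2 - τ) * c * (1 - l) - (τ - l) := by
    by_contra! h
    nlinarith
  have h8 : (2 - τ) * d * (1 - l) - (τ - l) < 0 := by
    by_contra! h
    nlinarith
  have h9 : 0 < (2 - τ) * (1 - l) * (d - c) :=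
    mul_pos (mul_pos (by linarith) (by linarith)) (by linarith [hc.2, hd.1])
  nlinarith

lemma mul_binEntropy_div {a b : ℝ} (hb : 0 < b) (ha : 0 < a) (hab : a < b) :
    b * binEntropy (a / b) = negMulLog a + negMulLog (b - a) - negMulLog b := by
  have e : 1 - a / b = (b - a) / b := by field_simp
  rw [binEntropy_eq_negMulLog_add_negMulLog_one_sub, e]
  simp only [negMulLog]
  rw [log_div ha.ne' hb.ne', log_div (by linarith) hb.ne']
  field_simp
  ring

/-- Chain rule: given the first indicator, the second has mean `τ` or `x * (1 - τ) / (1 - x)`. -/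
lemma overlapRate_eq {τ x : ℝ} (hτ1 : τ < 1 / 2) (hx0 : 0 < x) (hx : x < τ) :
    overlapRate τ x = binEntropy x - x * binEntropy τ -
      (1 - x) * binEntropy (x * (1 - τ) / (1 - x)) := by
  have hτ0 : 0 < τ := by linarith
  have h3 := one_sub_two_sub_mul_pos hτ1 hx0 hx.le
  have h4 : 0 < x * (1 - τ) := mul_pos hx0 (by linarith)
  have e1 := mul_binEntropy_div (a := x * (1 - τ)) (b := 1 - x) (by linarith) h4 (by nlinarith)
  have e2 := mul_binEntropy_div (a := x * τ) (b := x) hx0 (by positivity) (by nlinarith)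
  rw [mul_div_cancel_left₀ _ hx0.ne'] at e2
  rw [e1, e2, binEntropy_eq_negMulLog_add_negMulLog_one_sub, overlapRate]
  ring_nf

lemma sigma₀_condition_iff {τ x e : ℝ} (hτ1 : τ < 1 / 2) (hx0 : 0 < x) (hx : x < τ) :
    (1 - x) * h (x * (1 - τ) / (1 - x)) + x * h τ + e < h x ↔ e * log 2 < overlapRate τ x := by
  have h2 : 0 < log 2 := log_pos (by norm_num)
  rw [overlapRate_eq hτ1 hx0 hx]
  have : (1 - x) * h (x * (1 - τ) / (1 - x)) + x * h τ + e < h x ↔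
      e < (binEntropy x - x * binEntropy τ -
      (1 - x) * binEntropy (x * (1 - τ) / (1 - x))) / log 2 := by
    simp only [h]
    constructor <;> intro h <;> ring_nf at h ⊢ <;> linarith
  rw [this, lt_div_iff₀ h2]

lemma tendsto_eps : Filter.Tendsto eps Filter.atTop (nhds 0) := by
  have h1 : Filter.Tendsto (fun n : ℕ => (1 : ℝ) / n) Filter.atTop (nhds 0) :=
    tendsto_one_div_atTop_nhds_zero_nat
  have h2 : Filter.Tendsto (fun n : ℕ => log (n : ℝ) / (n : ℝ)) Filter.atTop (nhds 0) :=
    (isLittleO_log_id_atTop.tendsto_div_nhds_zero).comp tendsto_natCast_atTop_atTop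
  have h3 := h1.add (h2.div_const (log 2))
  rw [zero_div, add_zero] at h3
  refine h3.congr fun n => ?_
  rw [eps, logb]
  ring

lemma bddAbove_sigma₀_set (n : ℕ) (τ : ℝ) : BddAbove {x : ℝ | 0 < x ∧ x < τ ∧
    (1 - x) * h (x * (1 - τ) / (1 - x)) + x * h τ + eps n < h x} :=
  ⟨τ, fun _ hx => hx.2.1.le⟩

lemma sigma₀_le (n : ℕ) {τ : ℝ} (hτ0 : 0 < τ) : sigma₀ n τ ≤ τ :=
  Real.sSup_le (fun _ hx => hx.2.1.le) hτ0.le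

theorem tendsto_sigma₀ {τ : ℝ} (hτ0 : 0 < τ) (hτ1 : τ < 1 / 2) :
    Filter.Tendsto (fun n : ℕ => sigma₀ n τ) Filter.atTop (nhds τ) := by
  refine tendsto_order.2 ⟨fun a ha => ?_, fun a ha =>
    Filter.Eventually.of_forall fun n => (sigma₀_le n hτ0).trans_lt ha⟩
  obtain ⟨x, hx1, hx2⟩ := exists_between (max_lt ha hτ0)
  have hx0 : 0 < x := (le_max_right _ _).trans_lt hx1
  have h1 : Filter.Tendsto (fun n => eps n * log 2) Filter.atTop (nhds 0) := by
    simpa using tendsto_eps.mul_const (log 2)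
  filter_upwards [h1.eventually_lt_const (overlapRate_pos hτ1 hx0 hx2)] with n hn
  exact ((le_max_left _ _).trans_lt hx1).trans_le (le_csSup (bddAbove_sigma₀_set n τ)
    ⟨hx0, hx2, (sigma₀_condition_iff hτ1 hx0 hx2).2 hn⟩)

/-- The claim amounts to `2 ^ (n - 2) ≤ n ^ 2`, with equality at `n = 8`. -/
lemma half_le_eps {n : ℕ} (hn : 0 < n) (hn8 : n ≤ 8) : 1 / 2 ≤ eps n := by
  have hn' : (0 : ℝ) < n := by exact_mod_cast hn
  have h1 : ∀ k : ℕ, 2 ^ k ≤ n ^ 2 → (k : ℝ) ≤ 2 * logb 2 n := fun k hk => by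
    rw [← Nat.cast_two (R := ℝ), ← logb_pow, Nat.cast_two,
      le_logb_iff_rpow_le (by norm_num) (by positivity), rpow_natCast]
    exact_mod_cast hk
  rw [eps, le_div_iff₀ hn']
  suffices (n : ℝ) ≤ 2 + 2 * logb 2 n by linarith
  have h2 : 2 ^ (n - 2) ≤ n ^ 2 := by interval_cases n <;> norm_num
  have h3 := h1 (n - 2) h2
  have h4 : (n : ℝ) ≤ 2 + (n - 2 : ℕ) := by exact_mod_cast (by omega : n ≤ 2 + (n - 2))
  linarith

/-- Below `σ₀`, the exponent `n * overlapRate τ x` exceeds `4 * binEntropy x` by a fixed factor. -/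
lemma exists_rate_bound {n : ℕ} (hn : 0 < n) {τ : ℝ} (hτ0 : 0 < τ) (hτ1 : τ < 1 / 2) :
    ∃ κ > 4, ∀ x, 0 < x → x < sigma₀ n τ → κ * binEntropy x ≤ n * overlapRate τ x := by
  have hn' : (0 : ℝ) < n := by exact_mod_cast hn
  have h2 : 0 < log 2 := log_pos (by norm_num)
  have hent := binEntropy_pos_of_lt hτ0 hτ1
  by_cases hne : ∃ b, 0 < b ∧ b < τ ∧ eps n * log 2 < overlapRate τ b
  swap
  -- Here `σ₀ = sSup ∅ = 0`, so no `x` qualifies and any constant above `4` will do.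
  · refine ⟨5, by norm_num, fun x hx0 hx => ?_⟩
    obtain ⟨b, hb, -⟩ := exists_lt_of_lt_csSup (by
      by_contra he
      rw [not_nonempty_iff_eq_empty] at he
      rw [sigma₀, he, Real.sSup_empty] at hx
      linarith) hx
    exact absurd ⟨b, hb.1, hb.2.1, (sigma₀_condition_iff hτ1 hb.1 hb.2.1).1 hb.2.2⟩ hne
  have hmono : ∀ b, 0 < b → b < τ → binEntropy b ≤ binEntropy τ := fun b hb hbτ =>
    binEntropy_strictMonoOn.monotoneOn ⟨hb.le, by norm_num at *; linarith⟩
      ⟨hτ0.le, by norm_num at *; linarith⟩ hbτ.le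
  obtain ⟨b, hb0, hbτ, hb⟩ := hne
  -- A single admissible `b` forces `ε_n < 1 / 2`, hence `n > 8` and `n * ε_n = 1 + log₂ n > 4`.
  have hlt := overlapRate_lt hτ1 hb0 hbτ
  have hle : binEntropy τ ≤ log 2 := binEntropy_le_log_two
  have hlt' : eps n * log 2 < τ * binEntropy τ :=
    (hb.trans hlt).trans_le (mul_le_mul_of_nonneg_left (hmono b hb0 hbτ) hτ0.le)
  have heps : eps n < 1 / 2 := by
    by_contra! h
    nlinarith
  have hn8 : 8 < n := by
    by_contra! h
    linarith [half_le_eps hn h]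
  have hlog : 3 < logb 2 n := by
    rw [lt_logb_iff_rpow_lt (by norm_num) hn']
    norm_num
    exact_mod_cast hn8
  have hneps : n * eps n = 1 + logb 2 n := by
    rw [eps]
    field_simp
  have hepos : 0 < eps n := by
    by_contra! h
    nlinarith
  -- Since the entropy at `τ` is at most `log 2`, this is at least `n * ε_n > 4`. Dividing by the
  -- entropy at `τ`, which dominates that at every admissible `c`, turns the constant bound at `c`
  -- into a ratio bound.
  refine ⟨n * (eps n * log 2 / binEntropy τ), ?_, fun x hx0 hx => ?_⟩
  · rw [gt_iff_lt, ← mul_div_assoc, ← mul_assoc, hneps, lt_div_iff₀ hent]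
    nlinarith
  · obtain ⟨c, hc, hxc⟩ := exists_lt_of_lt_csSup (by
      by_contra he
      rw [not_nonempty_iff_eq_empty] at he
      rw [sigma₀, he, Real.sSup_empty] at hx
      linarith) hx
    rw [mul_assoc]
    refine mul_le_mul_of_nonneg_left ?_ hn'.le
    refine le_overlapRate_of_le hτ1 (by positivity) ?_ hx0 hxc.le hc.2.1 ?_
    · rw [div_lt_one hent]
      nlinarith
    · have h3 := (sigma₀_condition_iff hτ1 hc.1 hc.2.1).1 hc.2.2
      refine le_trans ?_ h3.le
      rw [div_mul_eq_mul_div, div_le_iff₀ hent]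
      exact mul_le_mul_of_nonneg_left (hmono c hc.1 hc.2.1) (by positivity)

end BipartiteGraphCode

end

/-! ### Counting permutations with a large overlap. -/

noncomputable section

namespace BipartiteGraphCode

open Real Finset

section Counting

variable {α : Type*} [Fintype α] [DecidableEq α]

/-- Composing with a permutation that carries `M` to `K` matches the two sets. -/
lemma card_perm_map_eq (K M : Finset α) (h : #M = #K) :
    #{ρ : Equiv.Perm α | K.map ρ.toEmbedding = M} =
      #{ρ : Equiv.Perm α | K.map ρ.toEmbedding = K} := by
  obtain ⟨σ, hσ⟩ := Equiv.Perm.exists_map_finset_eq M K h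
  refine card_equiv (Equiv.mulLeft σ) fun ρ => ?_
  have e : K.map (σ * ρ).toEmbedding = (K.map ρ.toEmbedding).map σ.toEmbedding := by
    rw [Finset.map_map]; rfl
  simp only [mem_filter, mem_univ, true_and, Equiv.coe_mulLeft, e]
  exact (Finset.map_injective σ.toEmbedding).eq_iff.symm.trans (by rw [hσ])

/-- The image of a set under a random permutation is uniformly distributed. -/
lemma card_perm_map_mem (K : Finset α) (B : Finset (Finset α)) (hB : ∀ M ∈ B, #M = #K) :
    #{ρ : Equiv.Perm α | K.map ρ.toEmbedding ∈ B} * (Fintype.card α).choose #K =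
      #B * (Fintype.card α).factorial := by
  have key : ∀ B : Finset (Finset α), (∀ M ∈ B, #M = #K) →
      #{ρ : Equiv.Perm α | K.map ρ.toEmbedding ∈ B} =
        #B * #{ρ : Equiv.Perm α | K.map ρ.toEmbedding = K} := fun B hB => by
    rw [card_eq_sum_card_fiberwise (f := fun ρ : Equiv.Perm α => K.map ρ.toEmbedding) (t := B)
      (fun ρ hρ => by simpa using hρ), ← smul_eq_mul, ← sum_const]
    refine sum_congr rfl fun M hM => ?_
    rw [← card_perm_map_eq K M (hB M hM), filter_filter]
    congr 1
    ext ρ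
    simp only [mem_filter, mem_univ, true_and, and_iff_right_iff_imp]
    rintro rfl
    exact hM
  -- Taking all sets of size `#K` evaluates the order of the stabilizer of `K`, since every
  -- permutation is then counted.
  have h2 := key (powersetCard #K univ) fun M hM => (mem_powersetCard.1 hM).2
  rw [card_powersetCard, card_univ] at h2
  have h3 : #{ρ : Equiv.Perm α | K.map ρ.toEmbedding ∈ powersetCard #K univ} =
      (Fintype.card α).factorial := by
    rw [filter_true_of_mem, card_univ, Fintype.card_perm]
    intro ρ _
    simp [mem_powersetCard]
  rw [key B hB, ← h3, h2]
  ring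

/-- A Chernoff bound for the number of sets with a large intersection with a given set. -/
lemma card_large_inter_mul_le (L : Finset α) (k q : ℕ) {z w : ℝ} (hz : 1 ≤ z) (hw : 0 < w) :
    (#{M ∈ powersetCard k (univ : Finset α) | q ≤ #(M ∩ L)} : ℝ) * (z ^ q * w ^ k) ≤
      (1 + z * w) ^ #L * (1 + w) ^ (Fintype.card α - #L) := by
  -- Expanded over all subsets, this product gives each set that is counted a weight of at least `z
  -- ^ q * w ^ k`, because `z ≥ 1`.
  have h1 : ∏ i : α, (1 + (if i ∈ L then z * w else w)) =
      (1 + z * w) ^ #L * (1 + w) ^ (Fintype.card α - #L) := by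
    rw [← prod_mul_prod_compl L, prod_congr rfl (g := fun _ => 1 + z * w), prod_const,
      prod_congr rfl (s₁ := Lᶜ) (g := fun _ => 1 + w), prod_const, card_compl]
    · intro i hi
      rw [if_neg (mem_compl.1 hi)]
    · intro i hi
      rw [if_pos hi]
  have hpos : ∀ i : α, 0 ≤ if i ∈ L then z * w else w := fun i => by
    split_ifs <;> positivity
  rw [← h1, prod_one_add, ← nsmul_eq_mul, ← sum_const]
  refine le_trans (sum_le_sum (g := fun M => ∏ i ∈ M, if i ∈ L then z * w else w)
    fun M hM => ?_) (sum_le_sum_of_subset_of_nonneg (fun M _ => by simp)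
      fun M _ _ => prod_nonneg fun i _ => hpos i)
  obtain ⟨hM, hq⟩ := mem_filter.1 hM
  have h2 : ∏ i ∈ M, (if i ∈ L then z * w else w) = z ^ #(M ∩ L) * w ^ #M := by
    rw [← prod_const, ← prod_const, ← filter_mem_eq_inter, prod_filter, ← prod_mul_distrib]
    refine prod_congr rfl fun i _ => ?_
    split_ifs <;> simp
  rw [h2, (mem_powersetCard.1 hM).2]
  gcongr

end Counting

lemma exp_mul_binEntropy {k l : ℕ} (hk : 0 < k) (hl : 0 < l) :
    exp ((k + l : ℕ) * binEntropy (k / (k + l : ℕ))) * ((k : ℝ) ^ k * (l : ℝ) ^ l) =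
      ((k + l : ℕ) : ℝ) ^ (k + l) := by
  have hk' : (0 : ℝ) < k := by exact_mod_cast hk
  have hl' : (0 : ℝ) < l := by exact_mod_cast hl
  have h1 := mul_binEntropy_div (a := (k : ℝ)) (b := (k + l : ℕ)) (by positivity) hk'
    (by push_cast; linarith)
  rw [h1, ← exp_log (pow_pos hk' k), ← exp_log (pow_pos hl' l), ← exp_add, ← exp_add,
    ← exp_log (pow_pos (a := ((k + l : ℕ) : ℝ)) (by positivity) _)]
  simp only [log_pow, negMulLog]
  push_cast
  ring_nf

lemma sum_choose_mul_pow (k l : ℕ) :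
    ∑ j ∈ range (k + l + 1), k ^ j * l ^ (k + l - j) * (k + l).choose j = (k + l) ^ (k + l) :=
  (add_pow k l (k + l)).symm

/-- One term of the binomial expansion of `(k + l) ^ (k + l)` is at most the whole sum. -/
lemma choose_le_exp {k l : ℕ} (hk : 0 < k) (hl : 0 < l) :
    ((k + l).choose k : ℝ) ≤ exp ((k + l : ℕ) * binEntropy (k / (k + l : ℕ))) := by
  have h1 := exp_mul_binEntropy hk hl
  have h2 : k ^ k * l ^ (k + l - k) * (k + l).choose k ≤ (k + l) ^ (k + l) := by
    rw [← sum_choose_mul_pow]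
    exact single_le_sum (f := fun j => k ^ j * l ^ (k + l - j) * (k + l).choose j)
      (fun _ _ => Nat.zero_le _) (mem_range.2 (by omega))
  rw [Nat.add_sub_cancel_left] at h2
  have h3 : (k : ℝ) ^ k * (l : ℝ) ^ l * (k + l).choose k ≤ ((k + l : ℕ) : ℝ) ^ (k + l) := by
    exact_mod_cast h2
  rw [← h1] at h3
  have hk' : (0 : ℝ) < k := by exact_mod_cast hk
  have hl' : (0 : ℝ) < l := by exact_mod_cast hl
  refine le_of_mul_le_mul_left ?_ (show 0 < (k : ℝ) ^ k * (l : ℝ) ^ l by positivity)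
  linarith

/-- The mode of the binomial distribution with `k + l` trials and mean `k`. -/
lemma pow_mul_choose_le {k l : ℕ} (hl : 0 < l) {j : ℕ} (hj : j ≤ k + l) :
    k ^ j * l ^ (k + l - j) * (k + l).choose j ≤ k ^ k * l ^ l * (k + l).choose k := by
  -- Consecutive terms have ratio `(k + l - i) * k / ((i + 1) * l)`, which is `≥ 1` for `i < k` and
  -- `≤ 1` for `i ≥ k`.
  have step : ∀ i < k + l, (k ^ (i + 1) * l ^ (k + l - (i + 1)) * (k + l).choose (i + 1)) *
      ((i + 1) * l) = (k ^ i * l ^ (k + l - i) * (k + l).choose i) * ((k + l - i) * k) := by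
    intro i hi
    have e : k + l - i = (k + l - (i + 1)) + 1 := by omega
    have h := Nat.choose_succ_right_eq (k + l) i
    calc _ = k ^ (i + 1) * l ^ (k + l - (i + 1)) * l * ((k + l).choose (i + 1) * (i + 1)) := by
          ring
      _ = k ^ (i + 1) * (l ^ (k + l - (i + 1)) * l) * ((k + l).choose i * (k + l - i)) := by
          rw [h]; ring
      _ = _ := by
          rw [← pow_succ, ← e]
          ring
  have hmode : k ^ k * l ^ l * (k + l).choose k =
      k ^ k * l ^ (k + l - k) * (k + l).choose k := by rw [Nat.add_sub_cancel_left]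
  rw [hmode]
  rcases le_total j k with h | h
  · induction h using Nat.decreasingInduction with
    | self => exact le_rfl
    | of_succ i hi ih =>
      refine le_trans ?_ (ih (by omega))
      have hpos : 0 < (i + 1) * l := by positivity
      refine Nat.le_of_mul_le_mul_right ?_ hpos
      rw [step i (by omega)]
      refine Nat.mul_le_mul_left _ ?_
      rw [mul_comm]
      exact Nat.mul_le_mul (by omega) hi
  · induction j, h using Nat.le_induction with
    | base => exact le_rfl
    | succ i hi ih =>
      refine le_trans ?_ (ih (by omega))
      have hpos : 0 < (i + 1) * l := by positivity
      refine Nat.le_of_mul_le_mul_right ?_ hpos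
      rw [step i (by omega)]
      refine Nat.mul_le_mul_left _ ?_
      rw [mul_comm]
      exact Nat.mul_le_mul (by omega) (by omega)

/-- Each of the `k + l + 1` terms of the expansion is at most the modal one. -/
lemma exp_le_mul_choose {k l : ℕ} (hk : 0 < k) (hl : 0 < l) :
    exp ((k + l : ℕ) * binEntropy (k / (k + l : ℕ))) ≤ (k + l + 1) * (k + l).choose k := by
  have h1 := exp_mul_binEntropy hk hl
  have h2 : (k + l) ^ (k + l) ≤ (k + l + 1) * (k ^ k * l ^ l * (k + l).choose k) := by
    rw [← sum_choose_mul_pow]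
    refine (sum_le_card_nsmul _ _ _ fun j hj =>
      pow_mul_choose_le hl (Nat.lt_succ_iff.1 (mem_range.1 hj))).trans ?_
    simp
  have h3 : ((k + l : ℕ) : ℝ) ^ (k + l) ≤
      (k + l + 1) * ((k : ℝ) ^ k * (l : ℝ) ^ l * (k + l).choose k) := by exact_mod_cast h2
  rw [← h1] at h3
  have hk' : (0 : ℝ) < k := by exact_mod_cast hk
  have hl' : (0 : ℝ) < l := by exact_mod_cast hl
  refine le_of_mul_le_mul_right ?_ (show 0 < (k : ℝ) ^ k * (l : ℝ) ^ l by positivity)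
  linarith

lemma card_large_inter_le {α : Type*} [Fintype α] [DecidableEq α] (L : Finset α) (q : ℕ)
    {x τ : ℝ} (hτ1 : τ < 1 / 2) (hx0 : 0 < x) (hx : x < τ)
    (hL : (#L : ℝ) = x * Fintype.card α) (hq : (q : ℝ) = τ * #L) :
    (#{M ∈ powersetCard #L (univ : Finset α) | q ≤ #(M ∩ L)} : ℝ) ≤
      exp (Fintype.card α * (binEntropy x - overlapRate τ x)) := by
  have h3 := one_sub_two_sub_mul_pos hτ1 hx0 hx.le
  have hτ0 : 0 < τ := by linarith
  have h4 : 0 < 1 - τ := by linarith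
  have h5 : 0 < 1 - x := by linarith
  have hcard : ((Fintype.card α - #L : ℕ) : ℝ) = (1 - x) * Fintype.card α := by
    rw [Nat.cast_sub (card_le_univ L), hL]
    ring
  -- These weights include a point of `L` with probability `z * w / (1 + z * w) = τ` and any other
  -- point with probability `w / (1 + w) = (1 - τ) * x / (1 - x)`, so that the expected size is `#L`
  -- and the expected overlap is `q`. The condition `1 ≤ z` amounts to `x ≤ τ`.
  set w := (1 - τ) * x / (1 - (2 - τ) * x) with hw
  set z := τ * (1 - (2 - τ) * x) / ((1 - τ) ^ 2 * x) with hz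
  have hw0 : 0 < w := by positivity
  have hz1 : 1 ≤ z := by
    rw [hz, le_div_iff₀ (by positivity)]
    nlinarith
  have hz0 : 0 < z := by linarith
  have e1 : 1 + z * w = 1 / (1 - τ) := by
    rw [hz, hw]
    obtain ⟨r, hr⟩ : ∃ r, r = 1 - (2 - τ) * x := ⟨_, rfl⟩
    rw [← hr] at h3 ⊢
    field_simp
    ring
  have e2 : 1 + w = (1 - x) / (1 - (2 - τ) * x) := by
    rw [hw]
    rw [eq_div_iff h3.ne', add_mul, div_mul_cancel₀ _ h3.ne']
    ring
  have key := card_large_inter_mul_le L #L q hz1 hw0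
  have hpos : 0 < z ^ q * w ^ #L := by positivity
  rw [← le_div_iff₀ hpos] at key
  refine key.trans (le_of_eq ?_)
  have hA : 0 < (1 + z * w) ^ #L * (1 + w) ^ (Fintype.card α - #L) / (z ^ q * w ^ #L) := by
    positivity
  rw [← exp_log hA, log_div (by positivity) hpos.ne', log_mul (by positivity) (by positivity),
    log_mul (by positivity) (by positivity), log_pow, log_pow, log_pow, log_pow, e1, e2,
    log_div one_ne_zero h4.ne', log_div h5.ne' h3.ne', hz, hw,
    log_div (by positivity) (by positivity), log_div (by positivity) h3.ne',
    log_mul hτ0.ne' h3.ne', log_mul (by positivity) hx0.ne', log_mul h4.ne' hx0.ne', log_pow,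
    hcard, hq, hL, overlapRate, binEntropy_eq_negMulLog_add_negMulLog_one_sub]
  simp only [negMulLog, log_one]
  rw [log_mul hτ0.ne' hx0.ne', log_mul h4.ne' hx0.ne']
  congr 1
  push_cast
  ring

/-- The number of permutations that create a large overlap between two sets of density `x`. -/
lemma card_perm_large_inter_le {α : Type*} [Fintype α] [DecidableEq α] (K L : Finset α) (q : ℕ)
    {x τ : ℝ} (hτ1 : τ < 1 / 2) (hx0 : 0 < x) (hx : x < τ) (hKL : #K = #L) (hL0 : 0 < #L)
    (hL : (#L : ℝ) = x * Fintype.card α) (hq : (q : ℝ) = τ * #L) :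
    (#{ρ : Equiv.Perm α | q ≤ #(K.map ρ.toEmbedding ∩ L)} : ℝ) ≤
      (Fintype.card α).factorial *
        ((Fintype.card α + 1) * exp (-(Fintype.card α * overlapRate τ x))) := by
  have hN0 : 0 < Fintype.card α := hL0.trans_le (card_le_univ L)
  have hN0' : (0 : ℝ) < Fintype.card α := by exact_mod_cast hN0
  obtain ⟨l, hl⟩ := Nat.exists_eq_add_of_le (card_le_univ L)
  have hl0 : 0 < l := by
    have : (#L : ℝ) < Fintype.card α := by
      rw [hL]
      nlinarith
    have : #L < Fintype.card α := by exact_mod_cast this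
    omega
  have h1 := card_perm_map_mem K {M ∈ powersetCard #L (univ : Finset α) | q ≤ #(M ∩ L)}
    fun M hM => by rw [(mem_powersetCard.1 (mem_filter.1 hM).1).2, hKL]
  have h2 : #{ρ : Equiv.Perm α | K.map ρ.toEmbedding ∈
      ({M ∈ powersetCard #L (univ : Finset α) | q ≤ #(M ∩ L)} : Finset (Finset α))} =
      #{ρ : Equiv.Perm α | q ≤ #(K.map ρ.toEmbedding ∩ L)} := by
    congr 1
    ext ρ
    simp [mem_powersetCard, hKL]
  have h3 := card_large_inter_le L q hτ1 hx0 hx hL hq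
  -- Dividing by the number of sets of size `#L` cancels the entropy term, at the cost of the factor
  -- `N + 1`.
  have h4 := exp_le_mul_choose hL0 hl0
  have hdiv : (#L : ℝ) / Fintype.card α = x := by
    rw [hL]
    field_simp
  have hl' : (Fintype.card α : ℝ) = #L + l := by exact_mod_cast hl
  rw [← hl, hdiv, ← hl'] at h4
  rw [h2, hKL] at h1
  have h1' : (#{ρ : Equiv.Perm α | q ≤ #(K.map ρ.toEmbedding ∩ L)} : ℝ) *
      (Fintype.card α).choose #L =
      #{M ∈ powersetCard #L (univ : Finset α) | q ≤ #(M ∩ L)} * (Fintype.card α).factorial := by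
    exact_mod_cast h1
  rw [mul_sub, sub_eq_add_neg, exp_add] at h3
  have hC : (0 : ℝ) < (Fintype.card α).choose #L := by
    exact_mod_cast Nat.choose_pos (card_le_univ L)
  refine le_of_mul_le_mul_right ?_ hC
  rw [h1']
  calc _ ≤ exp (Fintype.card α * binEntropy x) * exp (-(Fintype.card α * overlapRate τ x)) *
        (Fintype.card α).factorial := by gcongr
    _ ≤ ((Fintype.card α + 1) * (Fintype.card α).choose #L) *
        exp (-(Fintype.card α * overlapRate τ x)) * (Fintype.card α).factorial := by gcongr
    _ = _ := by ring

end BipartiteGraphCode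

end

/-! ### Iterative decoding on sparse graphs. -/

noncomputable section

namespace BipartiteGraphCode

open Finset

lemma two_mul_add_one_le_hammingDist {n t : ℕ} {A : Submodule (ZMod 2) (Word n)}
    (hA : 2 * t + 1 ≤ minDist A) {x y : Word n} (hx : x ∈ A) (hy : y ∈ A) (hxy : x ≠ y) :
    2 * t + 1 ≤ hammingDist x y :=
  hA.trans (Nat.sInf_le ⟨x, hx, y, hy, hxy, rfl⟩)

lemma localDecode_eq {n t : ℕ} {A : Submodule (ZMod 2) (Word n)}
    (hA : 2 * t + 1 ≤ minDist A) {z c : Word n} (hc : c ∈ A) (hz : hammingDist z c ≤ t) :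
    localDecode A t z = c := by
  have huniq : ∀ x, x ∈ A ∧ hammingDist z x ≤ t → x = c := fun x hx => by
    by_contra hne
    have h1 := two_mul_add_one_le_hammingDist hA hx.1 hc hne
    have h2 := hammingDist_triangle x z c
    rw [hammingDist_comm x z] at h2
    omega
  have h : ∃! x : Word n, x ∈ A ∧ hammingDist z x ≤ t := ⟨c, ⟨hc, hz⟩, huniq⟩
  rw [localDecode, dif_pos h]
  exact huniq _ h.choose_spec.1

variable {n m : ℕ}

/-- The edges between a set of vertices in `V₁` and a set of vertices in `V₂`. -/
def edgesBetween (π : Equiv.Perm (Edge n m)) (S T : Finset (Fin m)) : Finset (Edge n m) :=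
  {e | e.1 ∈ S ∧ (π e).1 ∈ T}

/-- The vertices of `V₁` with an erroneous edge. -/
def badVertices₁ (y c : EdgeWord n m) : Finset (Fin m) :=
  {v | proj₁ y v ≠ proj₁ c v}

/-- The vertices of `V₂` with an erroneous edge. -/
def badVertices₂ (π : Equiv.Perm (Edge n m)) (y c : EdgeWord n m) : Finset (Fin m) :=
  {v | proj₂ π y v ≠ proj₂ π c v}

lemma fst_mem_badVertices₁ {y c : EdgeWord n m} {e : Edge n m} (h : y e ≠ c e) :
    e.1 ∈ badVertices₁ y c := by
  simp only [badVertices₁, mem_filter, mem_univ, true_and]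
  exact fun heq => h (congrFun heq e.2)

lemma fst_mem_badVertices₂ {π : Equiv.Perm (Edge n m)} {y c : EdgeWord n m} {e : Edge n m}
    (h : y e ≠ c e) : (π e).1 ∈ badVertices₂ π y c := by
  simp only [badVertices₂, mem_filter, mem_univ, true_and]
  refine fun heq => h ?_
  simpa [proj₂] using congrFun heq (π e).2

lemma eq_of_badVertices₁_eq_empty {y c : EdgeWord n m} (h : badVertices₁ y c = ∅) : y = c := by
  funext e
  by_contra hne
  simpa [h] using fst_mem_badVertices₁ hne

lemma eq_of_badVertices₂_eq_empty {π : Equiv.Perm (Edge n m)} {y c : EdgeWord n m}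
    (h : badVertices₂ π y c = ∅) : y = c := by
  funext e
  by_contra hne
  simpa [h] using fst_mem_badVertices₂ (π := π) hne

lemma proj₂_decode₂ (A : Submodule (ZMod 2) (Word n)) (t : ℕ) (π : Equiv.Perm (Edge n m))
    (y : EdgeWord n m) (v : Fin m) :
    proj₂ π (decode₂ A t π y) v = localDecode A t (proj₂ π y v) := by
  funext i
  simp [proj₂, decode₂]

lemma lt_hammingDist_of_mem_badVertices₁ {A : Submodule (ZMod 2) (Word n)} {t : ℕ}
    (hA : 2 * t + 1 ≤ minDist A) {π : Equiv.Perm (Edge n m)} {c : EdgeWord n m}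
    (hc : c ∈ graphCode A π) {y : EdgeWord n m} {v : Fin m}
    (hv : v ∈ badVertices₁ (decode₁ A t y) c) : t < hammingDist (proj₁ y v) (proj₁ c v) := by
  by_contra! h
  exact (mem_filter.1 hv).2 (localDecode_eq hA (hc.1 v) h)

lemma lt_hammingDist_of_mem_badVertices₂ {A : Submodule (ZMod 2) (Word n)} {t : ℕ}
    (hA : 2 * t + 1 ≤ minDist A) {π : Equiv.Perm (Edge n m)} {c : EdgeWord n m}
    (hc : c ∈ graphCode A π) {y : EdgeWord n m} {v : Fin m}
    (hv : v ∈ badVertices₂ π (decode₂ A t π y) c) :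
    t < hammingDist (proj₂ π y v) (proj₂ π c v) := by
  by_contra! h
  exact (mem_filter.1 hv).2 ((proj₂_decode₂ A t π y v).trans (localDecode_eq hA (hc.2 v) h))

lemma sum_hammingDist_proj₁ (y c : EdgeWord n m) (S : Finset (Fin m)) :
    ∑ v ∈ S, hammingDist (proj₁ y v) (proj₁ c v) = #{e : Edge n m | y e ≠ c e ∧ e.1 ∈ S} := by
  rw [card_eq_sum_card_fiberwise (f := Prod.fst) (t := S) (fun e he => by simp_all)]
  refine sum_congr rfl fun v hv => ?_
  rw [hammingDist]
  refine card_bij (fun i _ => (v, i)) (fun i hi => ?_) (fun i _ j _ h => (Prod.ext_iff.1 h).2)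
    fun e he => ?_
  · simpa [hv, proj₁] using (mem_filter.1 hi).2
  · simp only [mem_filter, mem_univ, true_and] at he
    obtain ⟨⟨h1, -⟩, rfl⟩ := he
    exact ⟨e.2, mem_filter.2 ⟨mem_univ _, h1⟩, rfl⟩

lemma sum_hammingDist_proj₂ (π : Equiv.Perm (Edge n m)) (y c : EdgeWord n m)
    (T : Finset (Fin m)) : ∑ v ∈ T, hammingDist (proj₂ π y v) (proj₂ π c v) =
      #{e : Edge n m | y e ≠ c e ∧ (π e).1 ∈ T} := by
  rw [card_eq_sum_card_fiberwise (f := fun e => (π e).1) (t := T) (fun e he => by simp_all)]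
  refine sum_congr rfl fun v hv => ?_
  rw [hammingDist]
  refine card_bij (fun i _ => π.symm (v, i)) (fun i hi => ?_)
    (fun i _ j _ h => (Prod.ext_iff.1 (π.symm.injective h)).2) fun e he => ?_
  · simpa [hv, proj₂] using (mem_filter.1 hi).2
  · simp only [mem_filter, mem_univ, true_and] at he
    obtain ⟨⟨h1, -⟩, rfl⟩ := he
    exact ⟨(π e).2, mem_filter.2 ⟨mem_univ _, by simpa [proj₂] using h1⟩, by simp⟩

/-- A graph in which any two vertex sets of the same size `s < σ * m` in the two parts are joined by
fewer than `s * t` edges. -/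
def IsSparse (π : Equiv.Perm (Edge n m)) (t : ℕ) (σ : ℝ) : Prop :=
  ∀ S T : Finset (Fin m), S.Nonempty → #S = #T → (#S : ℝ) < σ * m → #(edgesBetween π S T) < #S * t

variable {A : Submodule (ZMod 2) (Word n)} {t : ℕ} {π : Equiv.Perm (Edge n m)} {σ : ℝ}
  {c : EdgeWord n m}

/-- Each remaining bad vertex used up at least `t + 1` errors. The gap between `t + 1` and `t` makes
the inequality strict, which is what admits `σ = σ₀`. -/
lemma card_badVertices₁_first (hA : 2 * t + 1 ≤ minDist A) (hσ : 0 < σ) (ht : 0 < t) (hm : 0 < m)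
    (hc : c ∈ graphCode A π) (y : EdgeWord n m) (hy : (hammingDist y c : ℝ) ≤ σ * m * t) :
    (#(badVertices₁ (decode₁ A t y) c) : ℝ) < σ * m := by
  have h1 : #(badVertices₁ (decode₁ A t y) c) * (t + 1) ≤ hammingDist y c := by
    rw [← smul_eq_mul]
    refine (card_nsmul_le_sum _ _ _ fun v hv =>
      lt_hammingDist_of_mem_badVertices₁ hA hc hv).trans ?_
    rw [sum_hammingDist_proj₁, hammingDist]
    exact card_le_card fun e he => by simp_all
  have h2 : (#(badVertices₁ (decode₁ A t y) c) : ℝ) * (t + 1) ≤ σ * m * t :=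
    le_trans (by exact_mod_cast h1) hy
  have hm' : (0 : ℝ) < m := by exact_mod_cast hm
  have ht' : (0 : ℝ) < t := by exact_mod_cast ht
  have h3 : 0 < σ * m := by positivity
  by_contra! h
  nlinarith

/-- Otherwise as many new bad vertices as there were old ones could be selected; each receives at
least `t + 1` edges from the old ones, too many for a sparse graph. -/
lemma card_badVertices₂_lt (hA : 2 * t + 1 ≤ minDist A) (hπ : IsSparse π t σ)
    (hc : c ∈ graphCode A π) (y : EdgeWord n m) (hne : (badVertices₁ y c).Nonempty)
    (hσ : (#(badVertices₁ y c) : ℝ) < σ * m) :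
    #(badVertices₂ π (decode₂ A t π y) c) < #(badVertices₁ y c) := by
  by_contra! h
  obtain ⟨T, hT, hcard⟩ := exists_subset_card_eq h
  have h1 := hπ _ T hne hcard.symm hσ
  have h2 : #T * (t + 1) ≤ #(edgesBetween π (badVertices₁ y c) T) := by
    rw [← smul_eq_mul]
    refine (card_nsmul_le_sum _ _ _ fun v hv =>
      lt_hammingDist_of_mem_badVertices₂ hA hc (hT hv)).trans ?_
    rw [sum_hammingDist_proj₂]
    refine card_le_card fun e he => ?_
    simp only [mem_filter, mem_univ, true_and, edgesBetween] at he ⊢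
    exact ⟨fst_mem_badVertices₁ he.1, he.2⟩
  rw [hcard] at h2
  nlinarith

lemma card_badVertices₁_lt (hA : 2 * t + 1 ≤ minDist A) (hπ : IsSparse π t σ)
    (hc : c ∈ graphCode A π) (y : EdgeWord n m) (hne : (badVertices₂ π y c).Nonempty)
    (hσ : (#(badVertices₂ π y c) : ℝ) < σ * m) :
    #(badVertices₁ (decode₁ A t y) c) < #(badVertices₂ π y c) := by
  by_contra! h
  obtain ⟨S, hS, hcard⟩ := exists_subset_card_eq h
  have h1 := hπ S _ (card_pos.1 (hcard ▸ hne.card_pos)) hcard (hcard ▸ hσ)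
  have h2 : #S * (t + 1) ≤ #(edgesBetween π S (badVertices₂ π y c)) := by
    rw [← smul_eq_mul]
    refine (card_nsmul_le_sum _ _ _ fun v hv =>
      lt_hammingDist_of_mem_badVertices₁ hA hc (hS hv)).trans ?_
    rw [sum_hammingDist_proj₁]
    refine card_le_card fun e he => ?_
    simp only [mem_filter, mem_univ, true_and, edgesBetween] at he ⊢
    exact ⟨he.2, fst_mem_badVertices₂ he.1⟩
  nlinarith

lemma decode₁_codeword (hA : 2 * t + 1 ≤ minDist A) (hc : c ∈ graphCode A π) :
    decode₁ A t c = c := by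
  funext e
  rw [decode₁, localDecode_eq hA (hc.1 e.1) (by simp)]
  rfl

lemma decode₂_codeword (hA : 2 * t + 1 ≤ minDist A) (hc : c ∈ graphCode A π) :
    decode₂ A t π c = c := by
  funext e
  rw [decode₂, localDecode_eq hA (hc.2 (π e).1) (by simp)]
  simp [proj₂]

lemma iterDecode_of_eq (hA : 2 * t + 1 ≤ minDist A) (hc : c ∈ graphCode A π) (y : EdgeWord n m)
    {k l : ℕ} (hk : iterDecode A t π y k = c) (hkl : k ≤ l) : iterDecode A t π y l = c := by
  induction l, hkl using Nat.le_induction with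
  | base => exact hk
  | succ l _ ih =>
    rw [iterDecode, ih, decode₁_codeword hA hc, decode₂_codeword hA hc, ite_self]

/-- The vertices with an erroneous edge, in the part that was decoded in iteration `k`. -/
def badVertices (A : Submodule (ZMod 2) (Word n)) (t : ℕ) (π : Equiv.Perm (Edge n m))
    (y c : EdgeWord n m) (k : ℕ) : Finset (Fin m) :=
  if Even k then badVertices₂ π (iterDecode A t π y k) c
  else badVertices₁ (iterDecode A t π y k) c

lemma badVertices_succ_lt (hA : 2 * t + 1 ≤ minDist A) (hπ : IsSparse π t σ)
    (hc : c ∈ graphCode A π) (y : EdgeWord n m) (k : ℕ)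
    (hne : (badVertices A t π y c k).Nonempty)
    (hσ : (#(badVertices A t π y c k) : ℝ) < σ * m) :
    #(badVertices A t π y c (k + 1)) < #(badVertices A t π y c k) := by
  rcases Nat.even_or_odd k with hk | hk
  · have hk' : ¬ Even (k + 1) := by simpa [Nat.even_add_one] using hk
    simp only [badVertices, hk, hk', if_true, if_false, iterDecode] at hne hσ ⊢
    exact card_badVertices₁_lt hA hπ hc _ hne hσ
  · have hk' : Even (k + 1) := hk.add_one
    have hk : ¬ Even k := Nat.not_even_iff_odd.2 hk
    simp only [badVertices, hk, hk', if_true, if_false, iterDecode] at hne hσ ⊢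
    exact card_badVertices₂_lt hA hπ hc _ hne hσ

lemma iterDecode_eq_of_badVertices_eq_empty {y : EdgeWord n m} {k : ℕ}
    (h : badVertices A t π y c k = ∅) : iterDecode A t π y k = c := by
  rw [badVertices] at h
  split_ifs at h
  · exact eq_of_badVertices₂_eq_empty h
  · exact eq_of_badVertices₁_eq_empty h

theorem IsSparse.correctsErrors (hA : 2 * t + 1 ≤ minDist A) (hπ : IsSparse π t σ) (hσ : 0 < σ)
    (ht : 0 < t) (hm : 0 < m) : CorrectsErrors A t π (σ * m * t) := by
  -- At most `m` vertices are bad after iteration `1`, and each further iteration removes at least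
  -- one, so `m` more suffice.
  refine ⟨m + 1, fun c hc y hy k hk => ?_⟩
  by_contra hne
  have hbad : ∀ j ≤ m + 1, (badVertices A t π y c j).Nonempty := fun j hj => by
    rw [nonempty_iff_ne_empty]
    exact fun he => hne (iterDecode_of_eq hA hc y (iterDecode_eq_of_badVertices_eq_empty he)
      (hj.trans hk))
  have key : ∀ j ≤ m, #(badVertices A t π y c (j + 1)) + j ≤ m ∧
      (#(badVertices A t π y c (j + 1)) : ℝ) < σ * m := fun j => by
    induction j with
    | zero =>
      refine fun _ => ⟨by simpa using card_le_univ (badVertices A t π y c 1), ?_⟩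
      simpa [badVertices, iterDecode] using card_badVertices₁_first hA hσ ht hm hc y hy
    | succ j ih =>
      intro hj
      obtain ⟨h1, h2⟩ := ih (by omega)
      have h3 := badVertices_succ_lt hA hπ hc y (j + 1) (hbad _ (by omega)) h2
      exact ⟨by omega, lt_trans (by exact_mod_cast h3) h2⟩
  have h1 := (key m le_rfl).1
  have h2 := (hbad (m + 1) le_rfl).card_pos
  omega

lemma correctsErrors_of_nonpos (hA : 2 * t + 1 ≤ minDist A) (π : Equiv.Perm (Edge n m)) {w : ℝ}
    (hw : w ≤ 0) : CorrectsErrors A t π w := by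
  refine ⟨0, fun c hc y hy k _ => ?_⟩
  have h0 : hammingDist y c = 0 := by exact_mod_cast le_antisymm (hy.trans hw) (Nat.cast_nonneg _)
  exact iterDecode_of_eq hA hc y (k := 0) (hammingDist_eq_zero.1 h0) k.zero_le

end BipartiteGraphCode

end

/-! ### The union bound over pairs of vertex sets. -/

noncomputable section

namespace BipartiteGraphCode

open Finset Filter

lemma le_choose : ∀ {m s : ℕ}, 0 < s → s < m → m ≤ m.choose s
  | 0, _, _, h => absurd h (Nat.not_lt_zero _)
  | m + 1, 0, h, _ => absurd h (lt_irrefl 0)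
  | m + 1, 1, _, _ => by simp
  | m + 1, s + 2, _, h => by
    have h1 : m ≤ m.choose (s + 1) := le_choose (Nat.succ_pos s) (Nat.lt_of_succ_lt_succ h)
    have h2 : 0 < m.choose (s + 1 + 1) := Nat.choose_pos (by omega)
    rw [Nat.choose_succ_succ']
    omega

/-- With `y = m * H (s / m)`, the left side is at most `exp y ^ (2 - κ)`. The exponent is
nonpositive and `exp y ≥ m.choose s ≥ m`. -/
lemma choose_sq_mul_exp_le {m s : ℕ} (hs : 0 < s) (hsm : s < m) {κ : ℝ} (hκ : 2 ≤ κ) :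
    (m.choose s : ℝ) ^ 2 * Real.exp (-(κ * (m * Real.binEntropy (s / m)))) ≤
      (m : ℝ) ^ (2 - κ) := by
  obtain ⟨l, rfl⟩ := Nat.exists_eq_add_of_le hsm.le
  have h1 := choose_le_exp hs (show 0 < l by omega)
  have h2 : ((s + l : ℕ) : ℝ) ≤ (s + l).choose s := by exact_mod_cast le_choose hs hsm
  have hm : (0 : ℝ) < (s + l : ℕ) := by exact_mod_cast (by omega : 0 < s + l)
  set y := ((s + l : ℕ) : ℝ) * Real.binEntropy (s / (s + l : ℕ))
  calc _ ≤ Real.exp y ^ 2 * Real.exp (-(κ * y)) := by gcongr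
    _ = Real.exp y ^ (2 - κ) := by
      rw [← Real.exp_mul, ← Real.exp_nat_mul, ← Real.exp_add]
      congr 1
      push_cast
      ring
    _ ≤ _ := Real.rpow_le_rpow_of_nonpos hm (h2.trans h1) (by linarith)

variable {n m : ℕ}

lemma card_edgesBetween (π : Equiv.Perm (Edge n m)) (S T : Finset (Fin m)) :
    #(edgesBetween π S T) =
      #((S ×ˢ (univ : Finset (Fin n))).map π.toEmbedding ∩ T ×ˢ (univ : Finset (Fin n))) := by
  rw [← card_map π.toEmbedding]
  congr 1
  ext e
  simp only [edgesBetween, mem_map_equiv, mem_inter, mem_filter, mem_univ, true_and, mem_product,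
    and_true, Equiv.apply_symm_apply]

/-- The number of graphs in which two given vertex sets are joined by many edges. -/
lemma card_dense_le {t : ℕ} {τ κ : ℝ} (hn : 0 < n) (hτ1 : τ < 1 / 2) (ht : (t : ℝ) = τ * n)
    {S T : Finset (Fin m)} (hS : 0 < #S) (hST : #S = #T) (hSτ : (#S / m : ℝ) < τ)
    (hκ : κ * Real.binEntropy (#S / m) ≤ n * overlapRate τ (#S / m)) :
    (#{π : Equiv.Perm (Edge n m) | #S * t ≤ #(edgesBetween π S T)} : ℝ) ≤
      (m * n).factorial * ((m * n + 1) *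
        Real.exp (-(κ * (m * Real.binEntropy (#S / m))))) := by
  have hm : 0 < m := hS.trans_le ((card_le_univ S).trans (by simp))
  have hm' : (0 : ℝ) < m := by exact_mod_cast hm
  have hS' : (0 : ℝ) < #S := by exact_mod_cast hS
  have hcard : Fintype.card (Edge n m) = m * n := by simp
  have hL : #(T ×ˢ (univ : Finset (Fin n))) = #S * n := by simp [card_product, hST]
  have h1 := card_perm_large_inter_le (S ×ˢ (univ : Finset (Fin n)))
    (T ×ˢ (univ : Finset (Fin n))) (#S * t) hτ1 (x := #S / m) (by positivity) hSτ
    (by simp [card_product, hST]) (by rw [hL]; positivity)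
    (by rw [hL, hcard]; push_cast; field_simp) (by rw [hL]; push_cast; rw [ht]; ring)
  simp only [card_edgesBetween]
  rw [hcard] at h1
  push_cast at h1
  refine h1.trans ?_
  have h2 := mul_le_mul_of_nonneg_left hκ hm'.le
  gcongr ?_ * (?_ * Real.exp ?_)
  linarith

/-- If every graph had a dense pair, the permutations would be covered by the sets counted in
`card_dense_le`. At most `m` sizes occur, each contributing at most the fraction `(m * n + 1) * m ^
(2 - κ)`. -/
lemma exists_isSparse_of_lt {t : ℕ} {τ κ σ : ℝ} (hn : 0 < n) (hτ1 : τ < 1 / 2)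
    (ht : (t : ℝ) = τ * n) (hκ : 4 < κ) (hσ : σ ≤ τ)
    (hrate : ∀ x, 0 < x → x < σ → κ * Real.binEntropy x ≤ n * overlapRate τ x)
    (hm : 0 < m) (hsmall : (m : ℝ) * ((m * n + 1) * (m : ℝ) ^ (2 - κ)) < 1) :
    ∃ π : Equiv.Perm (Edge n m), IsSparse π t σ := by
  by_contra! hno
  have hm' : (0 : ℝ) < m := by exact_mod_cast hm
  let I : Finset ℕ := {s ∈ range m | 0 < s ∧ (s : ℝ) < σ * m}
  let dense : Finset (Fin m) × Finset (Fin m) → Finset (Equiv.Perm (Edge n m)) :=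
    fun P => {π | #P.1 * t ≤ #(edgesBetween π P.1 P.2)}
  let pairs : ℕ → Finset (Finset (Fin m) × Finset (Fin m)) :=
    fun s => powersetCard s univ ×ˢ powersetCard s univ
  have hcover : (univ : Finset (Equiv.Perm (Edge n m))) ⊆
      I.biUnion fun s => (pairs s).biUnion dense := fun π _ => by
    have h := hno π
    simp only [IsSparse, not_forall, not_lt] at h
    obtain ⟨S, T, hS, hST, hlt, hle⟩ := h
    simp only [mem_biUnion]
    refine ⟨#S, mem_filter.2 ⟨mem_range.2 ?_, hS.card_pos, hlt⟩, (S, T), ?_, ?_⟩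
    · have : (#S : ℝ) < m := by nlinarith
      exact_mod_cast this
    · simp [pairs, mem_powersetCard, hST]
    · simpa [dense] using hle
  have hdense : ∀ s ∈ I, ∀ P ∈ pairs s, (#(dense P) : ℝ) ≤ (m * n).factorial * ((m * n + 1) *
      Real.exp (-(κ * (m * Real.binEntropy (s / m))))) := fun s hs P hP => by
    obtain ⟨-, hs0, hsσ⟩ := mem_filter.1 hs
    simp only [pairs, mem_product, mem_powersetCard, subset_univ, true_and] at hP
    obtain ⟨h1, h2⟩ := hP
    subst h1
    have hs0' : (0 : ℝ) < #P.1 := by exact_mod_cast hs0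
    have hx : (#P.1 / m : ℝ) < σ := by rwa [div_lt_iff₀ hm']
    exact card_dense_le hn hτ1 ht hs0 h2.symm (hx.trans_le hσ) (hrate _ (by positivity) hx)
  have hterm : ∀ s ∈ I, (#((pairs s).biUnion dense) : ℝ) ≤
      (m * n).factorial * ((m * n + 1) * (m : ℝ) ^ (2 - κ)) := fun s hs => by
    have h1 : (#((pairs s).biUnion dense) : ℝ) ≤ ∑ P ∈ pairs s, (#(dense P) : ℝ) := by
      exact_mod_cast card_biUnion_le
    have h2 := sum_le_card_nsmul _ _ _ (hdense s hs)
    refine (h1.trans h2).trans ?_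
    obtain ⟨hsm, hs0, -⟩ := mem_filter.1 hs
    have h3 := choose_sq_mul_exp_le hs0 (mem_range.1 hsm) (by linarith : 2 ≤ κ)
    simp only [pairs, card_product, card_powersetCard, card_univ, Fintype.card_fin, nsmul_eq_mul]
    push_cast
    calc _ = ((m * n).factorial : ℝ) * ((m * n + 1) * ((m.choose s : ℝ) ^ 2 *
          Real.exp (-(κ * (m * Real.binEntropy (s / m)))))) := by ring
      _ ≤ _ := by gcongr
  have h1 : ((m * n).factorial : ℝ) ≤ ∑ s ∈ I, (#((pairs s).biUnion dense) : ℝ) := by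
    have h := (card_le_card hcover).trans card_biUnion_le
    rw [card_univ, Fintype.card_perm] at h
    simp only [Fintype.card_prod, Fintype.card_fin] at h
    exact_mod_cast h
  have h2 := h1.trans (sum_le_card_nsmul _ _ _ hterm)
  have h3 : (#I : ℝ) ≤ m := by
    exact_mod_cast (card_filter_le _ _).trans (card_range m).le
  have h4 : (0 : ℝ) < (m * n).factorial := by exact_mod_cast Nat.factorial_pos _
  rw [nsmul_eq_mul] at h2
  have h5 : ((m * n).factorial : ℝ) ≤
      (m * n).factorial * ((m : ℝ) * ((m * n + 1) * (m : ℝ) ^ (2 - κ))) :=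
    calc _ ≤ _ := h2
      _ ≤ (m : ℝ) * ((m * n).factorial * ((m * n + 1) * (m : ℝ) ^ (2 - κ))) := by gcongr
      _ = _ := by ring
  nlinarith

/-- The threshold `4` is `2 + 1 + 1`: pairs of sets, the number of sizes, and the factor `N + 1`,
which is linear in `m`. -/
lemma eventually_union_bound_lt_one (n : ℕ) {κ : ℝ} (hκ : 4 < κ) :
    ∀ᶠ m : ℕ in atTop, (m : ℝ) * ((m * n + 1) * (m : ℝ) ^ (2 - κ)) < 1 := by
  have h1 : Tendsto (fun m : ℕ => (n + 1 : ℝ) * (m : ℝ) ^ (-(κ - 4))) atTop (nhds 0) := by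
    simpa using ((tendsto_rpow_neg_atTop (by linarith : 0 < κ - 4)).comp
      tendsto_natCast_atTop_atTop).const_mul (n + 1 : ℝ)
  filter_upwards [h1.eventually_lt_const one_pos, eventually_gt_atTop 0] with m hm hm0
  have hm0' : (0 : ℝ) < m := by exact_mod_cast hm0
  have hm1 : (1 : ℝ) ≤ m := by exact_mod_cast hm0
  refine lt_of_le_of_lt ?_ hm
  have e : (m : ℝ) ^ (-(κ - 4)) = (m : ℝ) ^ 2 * (m : ℝ) ^ (2 - κ) := by
    rw [← Real.rpow_natCast, ← Real.rpow_add hm0']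
    congr 1
    push_cast
    ring
  rw [e]
  have hp : (0 : ℝ) < (m : ℝ) ^ (2 - κ) := Real.rpow_pos_of_pos hm0' _
  calc _ ≤ (m : ℝ) * ((m * n + m) * (m : ℝ) ^ (2 - κ)) := by gcongr
    _ = _ := by ring

lemma pos_of_minDist {n t : ℕ} {A : Submodule (ZMod 2) (Word n)} (hA : 2 * t + 1 ≤ minDist A) :
    0 < n := by
  rcases Nat.eq_zero_or_pos n with rfl | hn
  · have hempty : {d : ℕ | ∃ x ∈ A, ∃ y ∈ A, x ≠ y ∧ hammingDist x y = d} = ∅ := by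
      ext d
      simp only [Set.mem_ofPred_eq, Set.mem_empty_iff_false, iff_false]
      rintro ⟨x, -, y, -, hxy, -⟩
      exact hxy (Subsingleton.elim x y)
    rw [minDist, hempty, Nat.sInf_empty] at hA
    omega
  · exact hn

theorem eventually_exists_correctsErrors {τ : ℝ} (hτ₀ : 0 < τ) (hτ₁ : τ < 1 / 2) (n t : ℕ)
    (A : Submodule (ZMod 2) (Word n)) (ht : (t : ℝ) = τ * n) (hA : 2 * t + 1 ≤ minDist A) (σ : ℝ)
    (hσ : σ ≤ sigma₀ n τ) :
    ∀ᶠ m : ℕ in atTop, ∃ π : Equiv.Perm (Edge n m),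
      CorrectsErrors A t π (σ * τ * ((n : ℝ) * m)) := by
  have hn := pos_of_minDist hA
  have hn' : (0 : ℝ) < n := by exact_mod_cast hn
  rcases le_or_gt σ 0 with hσ0 | hσ0
  -- For `σ ≤ 0` no errors are allowed, and every graph works.
  · refine Eventually.of_forall fun m => ⟨1, correctsErrors_of_nonpos hA 1 ?_⟩
    have : 0 ≤ τ * ((n : ℝ) * m) := by positivity
    nlinarith
  · have ht0 : 0 < t := by
      have : (0 : ℝ) < t := by rw [ht]; positivity
      exact_mod_cast this
    obtain ⟨κ, hκ, hrate⟩ := exists_rate_bound hn hτ₀ hτ₁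
    filter_upwards [eventually_union_bound_lt_one n hκ, eventually_gt_atTop 0] with m hsmall hm
    obtain ⟨π, hπ⟩ := exists_isSparse_of_lt hn hτ₁ ht hκ (hσ.trans (sigma₀_le n hτ₀))
      (fun x hx0 hx => hrate x hx0 (hx.trans_le hσ)) hm hsmall
    refine ⟨π, ?_⟩
    have e : σ * τ * ((n : ℝ) * m) = σ * m * t := by rw [ht]; ring
    rw [e]
    exact hπ.correctsErrors hA hσ0 ht0 hm

end BipartiteGraphCode

end

theorem proposition2 (τ : ℝ) (hτ₀ : 0 < τ) (hτ₁ : τ < 1 / 2) :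
    (∀ (n t : ℕ) (A : Submodule (ZMod 2) (BipartiteGraphCode.Word n)),
      (t : ℝ) = τ * n → 2 * t + 1 ≤ BipartiteGraphCode.minDist A →
      ∀ σ : ℝ, σ ≤ BipartiteGraphCode.sigma₀ n τ →
        ∀ᶠ m : ℕ in Filter.atTop, ∃ π : Equiv.Perm (BipartiteGraphCode.Edge n m),
          BipartiteGraphCode.CorrectsErrors A t π (σ * τ * ((n : ℝ) * m))) ∧
    Filter.Tendsto (fun n : ℕ => BipartiteGraphCode.sigma₀ n τ) Filter.atTop (nhds τ) ∧
    (∀ ρ : ℝ, ρ < τ ^ 2 → ∃ n₀ : ℕ, ∀ n ≥ n₀,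
      ∀ (t : ℕ) (A : Submodule (ZMod 2) (BipartiteGraphCode.Word n)),
      (t : ℝ) = τ * n → 2 * t + 1 ≤ BipartiteGraphCode.minDist A →
        ∀ᶠ m : ℕ in Filter.atTop, ∃ π : Equiv.Perm (BipartiteGraphCode.Edge n m),
          BipartiteGraphCode.CorrectsErrors A t π (ρ * ((n : ℝ) * m))) := by
  refine ⟨fun n t A ht hA σ hσ => BipartiteGraphCode.eventually_exists_correctsErrors hτ₀ hτ₁ n t A
    ht hA σ hσ, BipartiteGraphCode.tendsto_sigma₀ hτ₀ hτ₁, fun ρ hρ => ?_⟩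
  -- The first part is used with `σ = ρ / τ`, which is eventually below `σ₀` by the limit.
  have hρτ : ρ / τ < τ := by rwa [div_lt_iff₀ hτ₀, ← sq]
  obtain ⟨n₀, hn₀⟩ := Filter.eventually_atTop.1
    ((BipartiteGraphCode.tendsto_sigma₀ hτ₀ hτ₁).eventually_const_lt hρτ)
  refine ⟨n₀, fun n hn t A ht hA => ?_⟩
  have key := BipartiteGraphCode.eventually_exists_correctsErrors hτ₀ hτ₁ n t A ht hA (ρ / τ)
    (hn₀ n hn).le
  rwa [div_mul_cancel₀ _ hτ₀.ne'] at key
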